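/- Corollary 4.8. An array is a finite family of rows of equal length, repetitions of rows being allowed. For integers $q \ge p \ge k \ge 1$, a $(q,p)$-alphabet reduction pair of arrays of strength $k$ is a pair $(Q,P)$ of arrays with $q$ columns on the symbol set $\{0,\ldots,q-1\}$ such that: $Q$ contains the row $0\,1\,\ldots\,q-1$ at least once; each row of $P$ involves at most $p$ distinct symbols; and, for any $k$ columns, the subarrays of $Q$ and $P$ formed by these columns coincide up to the order of their rows. A $(q,p)$-cover pair of arrays of strength $k$ is a pair $(N,D)$ of arrays with $q$ columns on the symbol set $\{0,1\}$ such that: $N$ contains the row $1\,1\,\ldots\,1$ at least once; each row of $D$ has at most $p$ non-zero coordinates; and, for any $k$ columns, the subarrays of $N$ and $D$ formed by these columns coincide up to the order of their rows. Let $\gamma(q,p,k)$ be the highest ratio, over all $(q,p)$-alphabet reduction pairs $(Q,P)$ of strength $k$, of the number of occurrences of $0\,1\,\ldots\,q-1$ in $Q$ to the number of rows of $P$. Let $\delta(q,p,k)$ be the highest ratio, over all $(q,p)$-cover pairs $(N,D)$ of strength $k$, of the number of occurrences of $1\,1\,\ldots\,1$ in $N$ to the number of rows of $D$. Let $k \ge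 1$, $p \ge k$ and $q > p$ be integers such that $p = k$ or $k \in \{1,2\}$. Then both highest ratios are attained, $\gamma(q,p,k) = \delta(q,p,k)$, and this common value is equal to $$\frac{2}{1 + \sum_{i=0}^{k} \binom{q}{i}\binom{q-i-1}{k-i}} \quad\text{if } p = k,$$ $$\frac{p}{q} \quad\text{if } k = 1,$$ $$\frac{\lceil p/2\rceil\,\lfloor p/2\rfloor}{(q-\lceil p/2\rceil)(q-\lfloor p/2\rfloor)} \quad\text{if } k = 2.$$ -/

import Mathlib

open Finset

/-- An array with `R` rows and `n` columns on the symbol set `α`;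
`M r` is the row of index `r` and `M r j` its coefficient in column `j`. -/
abbrev SymbolArray (R n : ℕ) (α : Type*) := Fin R → Fin n → α

/-- The array extracted from `M` by keeping the columns in `J` only, up to the order of its rows,
that is, the multiset of the rows of `M` restricted to `J`. -/
def SymbolArray.extract {R n : ℕ} {α : Type*} (M : SymbolArray R n α) (J : Finset (Fin n)) :
    Multiset (J → α) :=
  (univ : Finset (Fin R)).val.map (fun r (j : J) => M r j)

/-- The condition `(k_=)`: extracting any `k` columns from `M`, and the same `k` columns from `M'`,
gives the same array up to the order of the rows. -/
def SameExtractions {R S n : ℕ} {α : Type*} (k : ℕ)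
    (M : SymbolArray R n α) (M' : SymbolArray S n α) : Prop :=
  ∀ J : Finset (Fin n), #J = k → M.extract J = M'.extract J

/-- The number of occurrences of the row `u` in the array `M`. -/
def SymbolArray.occurrences {R n : ℕ} {α : Type*} [DecidableEq α]
    (M : SymbolArray R n α) (u : Fin n → α) : ℕ :=
  #{r : Fin R | M r = u}

/-- `(Q, P)` is a `(q, p)`-alphabet reduction pair of arrays of strength `k`. The symbol set
`{0, …, q - 1}` is `Fin q`, which also indexes the columns: the row `0 1 … q - 1` is the
identity map. -/
structure IsARPA (q p k : ℕ) {R S : ℕ}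
    (Q : SymbolArray R q (Fin q)) (P : SymbolArray S q (Fin q)) : Prop where
  /-- `Q` contains at least one occurrence of the row `0 1 … q - 1`. -/
  exists_row : ∃ r, Q r = fun j => j
  /-- Each row of `P` involves at most `p` distinct symbols. -/
  card_symbols_le : ∀ r, #(univ.image (P r)) ≤ p
  same : SameExtractions k Q P

/-- `(N, D)` is a `(ν, d)`-cover pair of arrays of strength `k`. -/
structure IsCPA (ν d k : ℕ) {R S : ℕ}
    (N : SymbolArray R ν (Fin 2)) (D : SymbolArray S ν (Fin 2)) : Prop where
  /-- `N` contains at least one occurrence of the row `1 1 … 1`. -/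
  exists_row : ∃ r, N r = fun _ => 1
  /-- Each row of `D` has at most `d` non-zero coordinates. -/
  card_nonzero_le : ∀ r, #{j | D r j ≠ 0} ≤ d
  same : SameExtractions k N D

/-- The ratios `R*(Q, P) / R(Q, P)` over all `(q, p)`-alphabet reduction pairs of arrays `(Q, P)`
of strength `k`, where `R*` is the number of occurrences of `0 1 … q - 1` in `Q`, and `R` the number
of rows of `P`. -/
def arpaRatios (q p k : ℕ) : Set ℝ :=
  {x | ∃ (R S : ℕ) (Q : SymbolArray R q (Fin q)) (P : SymbolArray S q (Fin q)),
    IsARPA q p k Q P ∧ x = (Q.occurrences (fun j => j) : ℝ) / (S : ℝ)}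

/-- The ratios `R*(N, D) / R(N, D)` over all `(ν, d)`-cover pairs of arrays `(N, D)` of
strength `k`, where `R*` is the number of occurrences of `1 1 … 1` in `N`, and `R` the number of
rows of `D`. -/
def cpaRatios (ν d k : ℕ) : Set ℝ :=
  {x | ∃ (R S : ℕ) (N : SymbolArray R ν (Fin 2)) (D : SymbolArray S ν (Fin 2)),
    IsCPA ν d k N D ∧ x = (N.occurrences (fun _ => 1) : ℝ) / (S : ℝ)}

/-- `γ(q, p, k)`: the highest ratio reached by a `(q, p)`-alphabet reduction pair of arrays of
strength `k`. -/
noncomputable def arpaGamma (q p k : ℕ) : ℝ := sSup (arpaRatios q p k)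

/-- `δ(ν, d, k)`: the highest ratio reached by a `(ν, d)`-cover pair of arrays of strength `k`. -/
noncomputable def cpaDelta (ν d k : ℕ) : ℝ := sSup (cpaRatios ν d k)

/-! Replacing each entry by the indicator that it equals its column index turns a reduction pair
into a cover pair with at least the same ratio (`arpaRatios_subset_cpaRatios`). So it suffices to
bound cover pairs from above and to exhibit reduction pairs that reach the bound
(`isGreatest_of_attained`).

Upper bound: this is linear programming duality. The two arrays of a cover pair agree on `k`
columns, so a polynomial of degree at most `k` in the number of nonzero coordinates of a row has the
same sum over both arrays. If it is nonnegative on `0, …, q` and at most `B` on `0, …, p`, the ratio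
is at most `B` over its value at `q` (`IsCPA.occurrences_mul_le`). The polynomials are `x` for `k =
1`, `(x - ⌈p/2⌉)(x - ⌊p/2⌋)` for `k = 2`, and for `p = k` one plus the polynomial that alternates
between `1` and `-1` on `0, …, k`.

Lower bound: for `k = 1`, cyclic shifts. For `p = k`, a recursion on the number of columns
(`IsReduction.step`) whose size obeys the Pascal-type rule `alternatingSum_succ`. For `k = 2`, a
weighted family of rows summed over all permutations of the columns other than `0`
(`sum_pairDefect`); its rows keep only numbers of columns at which the dual inequalities are
equalities. -/

/-! ### Binomial moments and the dual bound -/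

/-- An integer combination of the polynomials `x ↦ x.choose i` for `i ≤ k`. -/
def chooseComb (k : ℕ) (c : ℕ → ℤ) (x : ℕ) : ℤ :=
  ∑ i ∈ range (k + 1), c i * (x.choose i : ℤ)

/-- Since `k ≤ n`, a smaller set of columns extends to one of size `k`, where the extracted
multisets are equal. -/
theorem SameExtractions.card_filter_eq {R S n k : ℕ} {α : Type*} {M : SymbolArray R n α}
    {M' : SymbolArray S n α} (h : SameExtractions k M M') (hkn : k ≤ n) (J : Finset (Fin n))
    (hJ : #J ≤ k) (A : α → Prop) [DecidablePred A] :
    #{r | ∀ j ∈ J, A (M r j)} = #{r | ∀ j ∈ J, A (M' r j)} := by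
  classical
  obtain ⟨K, hJK, -, hK⟩ := Finset.exists_subsuperset_card_eq (subset_univ J) hJ
    (by simpa using hkn)
  have h1 := congrArg (Multiset.countP (fun g : K → α => ∀ j : K, (j : Fin n) ∈ J → A (g j)))
    (h K hK)
  simp only [SymbolArray.extract, Multiset.countP_map] at h1
  have key : ∀ {T : ℕ} (L : SymbolArray T n α), #{r | ∀ j ∈ J, A (L r j)} =
      Multiset.card (Multiset.filter
        (fun r => ∀ j : K, (j : Fin n) ∈ J → A (L r j)) (univ : Finset (Fin T)).val) := by
    intro T L
    rw [← Finset.filter_val]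
    change _ = #_
    congr 1
    ext r
    simp only [mem_filter, mem_univ, true_and]
    exact ⟨fun H j hj => H j hj, fun H j hj => H ⟨j, hJK hj⟩ hj⟩
  rw [key, key, h1]

/-- Double counting of the pairs formed by a row and an `i`-set of columns on which it satisfies
`A`. -/
theorem SameExtractions.sum_choose_eq {R S n k : ℕ} {α : Type*} {M : SymbolArray R n α}
    {M' : SymbolArray S n α} (h : SameExtractions k M M') (hkn : k ≤ n)
    {i : ℕ} (hi : i ≤ k) (A : α → Prop) [DecidablePred A] :
    ∑ r, (#{j | A (M r j)}).choose i = ∑ r, (#{j | A (M' r j)}).choose i := by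
  classical
  have key : ∀ {T : ℕ} (L : SymbolArray T n α), ∑ r, (#{j | A (L r j)}).choose i =
      ∑ J ∈ powersetCard i (univ : Finset (Fin n)), #{r | ∀ j ∈ J, A (L r j)} := by
    intro T L
    simp only [card_filter _ (univ : Finset (Fin T))]
    rw [sum_comm]
    refine sum_congr rfl fun r _ => ?_
    rw [← card_powersetCard, ← card_filter]
    congr 1
    ext J
    simp only [mem_powersetCard, mem_filter, true_and, subset_iff, mem_univ]
    tauto
  rw [key, key]
  refine sum_congr rfl fun J hJ => h.card_filter_eq hkn J ?_ A
  rw [(mem_powersetCard.1 hJ).2]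
  exact hi

theorem SameExtractions.sum_chooseComb_eq {R S n k : ℕ} {α : Type*} {M : SymbolArray R n α}
    {M' : SymbolArray S n α} (h : SameExtractions k M M') (hkn : k ≤ n) (c : ℕ → ℤ)
    (A : α → Prop) [DecidablePred A] :
    ∑ r, chooseComb k c #{j | A (M r j)} = ∑ r, chooseComb k c #{j | A (M' r j)} := by
  unfold chooseComb
  rw [sum_comm, sum_comm (s := univ)]
  refine sum_congr rfl fun i hi => ?_
  rw [← mul_sum, ← mul_sum]
  congr 1
  exact_mod_cast h.sum_choose_eq hkn (Nat.lt_succ_iff.1 (mem_range.1 hi)) A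

/-- The dual bound: a combination of the `x.choose i`, `i ≤ k`, that is nonnegative on `0, …, n`
and at most `B` on `0, …, d` bounds the ratios of cover pairs. -/
theorem IsCPA.occurrences_mul_le {n d k R S : ℕ} {N : SymbolArray R n (Fin 2)}
    {D : SymbolArray S n (Fin 2)} (h : IsCPA n d k N D) (hkn : k ≤ n) (c : ℕ → ℤ) (B : ℤ)
    (h0 : ∀ x ≤ n, 0 ≤ chooseComb k c x) (hB : ∀ x ≤ d, chooseComb k c x ≤ B) :
    (N.occurrences (fun _ => 1) : ℤ) * chooseComb k c n ≤ B * S := by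
  have h1 : ∑ r, chooseComb k c #{j | D r j ≠ 0} ≤ B * S := by
    calc _ ≤ ∑ _r : Fin S, B := sum_le_sum fun r _ => hB _ (h.card_nonzero_le r)
      _ = B * S := by simp [mul_comm]
  rw [← h.same.sum_chooseComb_eq hkn c (fun x => x ≠ 0)] at h1
  refine le_trans ?_ h1
  calc (N.occurrences (fun _ => 1) : ℤ) * chooseComb k c n
      = ∑ r ∈ ({r | N r = fun _ => 1} : Finset (Fin R)), chooseComb k c n := by
        simp [SymbolArray.occurrences]
    _ = ∑ r ∈ ({r | N r = fun _ => 1} : Finset (Fin R)), chooseComb k c #{j | N r j ≠ 0} := by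
        refine sum_congr rfl fun r hr => ?_
        rw [(mem_filter.1 hr).2]
        simp
    _ ≤ ∑ r, chooseComb k c #{j | N r j ≠ 0} :=
        sum_le_sum_of_subset_of_nonneg (subset_univ _) fun r _ _ =>
          h0 _ ((card_le_univ _).trans (by simp))

theorem IsCPA.card_pos {n d k R S : ℕ} {N : SymbolArray R n (Fin 2)}
    {D : SymbolArray S n (Fin 2)} (h : IsCPA n d k N D) (hkn : k ≤ n) : 0 < S := by
  obtain ⟨r, -⟩ := h.exists_row
  -- The empty set of columns shows that both arrays have the same number of rows.
  have h1 := h.same.card_filter_eq hkn ∅ (by simp) (fun _ => True)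
  simp only [notMem_empty, implies_true, filter_true, card_univ, Fintype.card_fin] at h1
  have := r.isLt
  omega

theorem le_of_mem_cpaRatios {n d k : ℕ} (hkn : k ≤ n) (c : ℕ → ℤ) (B : ℤ)
    (h0 : ∀ x ≤ n, 0 ≤ chooseComb k c x) (hB : ∀ x ≤ d, chooseComb k c x ≤ B)
    (hn : 0 < chooseComb k c n) {x : ℝ} (hx : x ∈ cpaRatios n d k) :
    x ≤ (B : ℝ) / (chooseComb k c n : ℝ) := by
  obtain ⟨R, S, N, D, h, rfl⟩ := hx
  have h1 : ((N.occurrences (fun _ => 1) : ℤ) : ℝ) * (chooseComb k c n : ℝ) ≤ B * (S : ℤ) := by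
    exact_mod_cast h.occurrences_mul_le hkn c B h0 hB
  have hS : (0 : ℝ) < S := by exact_mod_cast h.card_pos hkn
  have hn' : (0 : ℝ) < chooseComb k c n := by exact_mod_cast hn
  rw [div_le_div_iff₀ hS hn']
  simpa using h1

/-! ### From reduction pairs to cover pairs -/

/-- Mark the entries equal to their column index. Marked columns of one row carry distinct symbols,
so at most `p` of them occur in a row of `P`; only the identity row is marked everywhere. -/
theorem arpaRatios_subset_cpaRatios (q p k : ℕ) : arpaRatios q p k ⊆ cpaRatios q p k := by
  rintro x ⟨R, S, Q, P, h, rfl⟩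
  refine ⟨R, S, fun r j => if Q r j = j then 1 else 0, fun r j => if P r j = j then 1 else 0,
    ⟨?_, fun r => ?_, fun J hJ => ?_⟩, ?_⟩
  · obtain ⟨r, hr⟩ := h.exists_row
    exact ⟨r, by simp [hr]⟩
  · refine le_trans (card_le_card fun j hj => ?_) (h.card_symbols_le r)
    simp only [ne_eq, ite_eq_right_iff, one_ne_zero, imp_false, not_not, mem_filter, mem_univ,
      true_and] at hj
    exact mem_image.2 ⟨j, mem_univ _, hj⟩
  · have := congrArg (Multiset.map
      (fun (g : J → Fin q) (j : J) => if g j = j then (1 : Fin 2) else 0)) (h.same J hJ)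
    simpa [SymbolArray.extract, Multiset.map_map, Function.comp_def] using this
  · congr 2
    unfold SymbolArray.occurrences
    congr 1
    ext r
    simp [funext_iff]

/-- If a reduction pair reaches a bound for the ratios of cover pairs, then both maxima equal
that bound. -/
theorem isGreatest_of_attained {q p k : ℕ} {V : ℝ} (hub : ∀ x ∈ cpaRatios q p k, x ≤ V)
    (hV : ∃ x ∈ arpaRatios q p k, V ≤ x) :
    IsGreatest (arpaRatios q p k) V ∧ IsGreatest (cpaRatios q p k) V := by
  obtain ⟨x, hx, hVx⟩ := hV
  have hx' := arpaRatios_subset_cpaRatios q p k hx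
  obtain rfl : x = V := le_antisymm (hub x hx') hVx
  exact ⟨⟨hx, fun y hy => hub y (arpaRatios_subset_cpaRatios q p k hy)⟩, hx', hub⟩

/-- A reduction pair may be given by the multisets of the rows of its two arrays. -/
theorem ratio_mem_arpaRatios_of_multiset {q p k : ℕ} (Q P : Multiset (Fin q → Fin q))
    (hid : (fun j => j) ∈ Q) (hP : ∀ f ∈ P, #(univ.image f) ≤ p)
    (hsame : ∀ J : Finset (Fin q), #J = k → ∀ v : Fin q → Fin q,
      Q.countP (fun f => ∀ j ∈ J, f j = v j) = P.countP (fun f => ∀ j ∈ J, f j = v j)) :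
    (Q.count (fun j => j) : ℝ) / (Multiset.card P : ℝ) ∈ arpaRatios q p k := by
  classical
  induction Q using Quotient.inductionOn with | _ l
  induction P using Quotient.inductionOn with | _ m
  simp only [Multiset.quot_mk_to_coe] at *
  have hext : ∀ (l : List (Fin q → Fin q)) (J : Finset (Fin q)),
      SymbolArray.extract (α := Fin q) (fun r => l.get r) J =
        Multiset.map (fun f (j : J) => f j) (l : Multiset (Fin q → Fin q)) := by
    intro l J
    have : (l : Multiset (Fin q → Fin q)) = (univ : Finset (Fin l.length)).val.map l.get := by
      rw [Fin.univ_val_map, List.ofFn_get]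
    rw [this, Multiset.map_map]
    rfl
  refine ⟨l.length, m.length, fun r => l.get r, fun r => m.get r, ⟨?_, ?_, ?_⟩, ?_⟩
  · obtain ⟨r, hr⟩ := List.get_of_mem (by simpa using hid)
    exact ⟨r, hr⟩
  · exact fun r => hP _ (by simp)
  · intro J hJ
    rw [hext, hext]
    refine Multiset.ext.2 fun g => ?_
    rw [Multiset.count_map, Multiset.count_map, ← Multiset.countP_eq_card_filter,
      ← Multiset.countP_eq_card_filter]
    -- A prescription on `J` is extended to all columns by a default symbol, which needs `0 < q`.
    rcases Nat.eq_zero_or_pos q with rfl | hq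
    · have := hsame J hJ (fun j => j)
      convert this using 2 <;>
        simp [funext_iff]
    · have := hsame J hJ (fun j => if h : j ∈ J then g ⟨j, h⟩ else ⟨0, hq⟩)
      convert this using 2 <;>
      · simp only [funext_iff, Subtype.forall]
        refine forall₂_congr fun j hj => ?_
        simp [hj, eq_comm]
  · simp only [SymbolArray.occurrences, Multiset.coe_card]
    congr 2
    have : (l : Multiset (Fin q → Fin q)) = (univ : Finset (Fin l.length)).val.map l.get := by
      rw [Fin.univ_val_map, List.ofFn_get]
    rw [this, Multiset.count_map, ← Finset.filter_val]
    change #_ = #_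
    congr 1
    ext r
    simp [eq_comm]

/-! ### Alternating binomial sums -/

/-- The value at `q` of the polynomial of degree `k` that takes the values `±1` alternately at
`0, …, k`, and `1` at `k`. -/
def alternatingSum (q k : ℕ) : ℤ := ∑ i ∈ range (k + 1), (-1) ^ (k - i) * 2 ^ i * (q.choose i : ℤ)

theorem alternatingSum_zero (q : ℕ) : alternatingSum q 0 = 1 := by simp [alternatingSum]

theorem alternatingSum_add (q k : ℕ) :
    alternatingSum q (k + 1) + alternatingSum q k = 2 ^ (k + 1) * (q.choose (k + 1) : ℤ) := by
  unfold alternatingSum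
  rw [sum_range_succ _ (k + 1)]
  have : ∑ i ∈ range (k + 1), (-1 : ℤ) ^ (k + 1 - i) * 2 ^ i * (q.choose i : ℤ) =
      -∑ i ∈ range (k + 1), (-1 : ℤ) ^ (k - i) * 2 ^ i * (q.choose i : ℤ) := by
    rw [← sum_neg_distrib]
    refine sum_congr rfl fun i hi => ?_
    rw [Nat.sub_add_comm (Nat.lt_succ_iff.1 (mem_range.1 hi)), pow_succ]
    ring
  rw [this]
  simp

theorem alternatingSum_succ (q k : ℕ) :
    alternatingSum (q + 1) (k + 1) = alternatingSum q (k + 1) + 2 * alternatingSum q k := by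
  induction k with
  | zero =>
    have h1 := alternatingSum_add (q + 1) 0
    have h2 := alternatingSum_add q 0
    simp only [alternatingSum_zero, zero_add, Nat.choose_one_right] at *
    push_cast at *
    linarith
  | succ k ih =>
    have h1 := alternatingSum_add (q + 1) (k + 1)
    have h2 := alternatingSum_add q (k + 1)
    have h3 := alternatingSum_add q k
    rw [Nat.choose_succ_succ' q (k + 1)] at h1
    push_cast at h1
    rw [pow_succ 2 (k + 1)] at *
    linarith

/-- For `k = q` this is the binomial expansion of `(2 - 1) ^ q`; beyond that, the new binomial
coefficient vanishes and `alternatingSum_add` only flips the sign. -/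
theorem alternatingSum_of_le {q k : ℕ} (h : q ≤ k) : alternatingSum q k = (-1) ^ (k - q) := by
  induction k, h using Nat.le_induction with
  | base =>
    have := add_pow (2 : ℤ) (-1) q
    rw [Nat.sub_self, pow_zero]
    norm_num at this
    rw [alternatingSum]
    refine Eq.trans (sum_congr rfl fun i _ => ?_) this.symm
    ring
  | succ k hk ih =>
    have := alternatingSum_add q k
    rw [Nat.choose_eq_zero_of_lt (by omega), ih] at this
    rw [Nat.sub_add_comm hk, pow_succ]
    push_cast at this
    linarith

/-- Both sides obey the recurrence of `alternatingSum_add`: expand `2 ^ (k + 1)` as a sum of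
binomial coefficients, then use the product rule for `choose` and Pascal's rule. The left side makes
positivity visible. -/
theorem sum_choose_mul_choose_eq_alternatingSum {q k : ℕ} (h : k < q) :
    (∑ i ∈ range (k + 1), (q.choose i : ℤ) * ((q - i - 1).choose (k - i) : ℤ)) =
      alternatingSum q k := by
  induction k with
  | zero => simp [alternatingSum_zero]
  | succ k ih =>
    have h1 := alternatingSum_add q k
    rw [← ih (by omega)] at h1
    rw [eq_sub_of_add_eq h1, eq_sub_iff_add_eq, sum_range_succ _ (k + 1),
      add_right_comm, ← sum_add_distrib]
    have h2 : (2 : ℤ) ^ (k + 1) = ∑ i ∈ range (k + 2), ((k + 1).choose i : ℤ) := by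
      exact_mod_cast (Nat.sum_range_choose (k + 1)).symm
    rw [h2, sum_mul, sum_range_succ _ (k + 1)]
    congr 1
    · refine sum_congr rfl fun i hi => ?_
      have hi' := mem_range.1 hi
      rw [← mul_add]
      have e1 : k + 1 - i = k - i + 1 := by omega
      have e2 : q - i = q - i - 1 + 1 := by omega
      have h3 : ((q - i).choose (k + 1 - i) : ℤ) =
          (q - i - 1).choose (k + 1 - i) + (q - i - 1).choose (k - i) := by
        rw [e1, e2, Nat.choose_succ_succ', Nat.add_sub_cancel]
        push_cast
        ring
      rw [← h3]
      have := Nat.choose_mul (n := q) (k := k + 1) (s := i) (by omega)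
      rw [mul_comm ((k + 1).choose i : ℤ)]
      exact_mod_cast this.symm
    · simp

theorem alternatingSum_nonneg {q k : ℕ} (h : k < q) : 0 ≤ alternatingSum q k := by
  rw [← sum_choose_mul_choose_eq_alternatingSum h]
  positivity

/-! ### Upper bounds from explicit polynomials -/

theorem le_of_mem_cpaRatios_self {q k : ℕ} (h : k < q) {x : ℝ} (hx : x ∈ cpaRatios q k k) :
    x ≤ 2 / (1 + alternatingSum q k : ℝ) := by
  -- One plus the alternating polynomial: its values are `0` and `2` on `0, …, k`, and it is
  -- positive beyond.
  set c : ℕ → ℤ := fun i => (if i = 0 then 1 else 0) + (-1) ^ (k - i) * 2 ^ i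
  have hc : ∀ x, chooseComb k c x = 1 + alternatingSum x k := by
    intro x
    simp only [chooseComb, c, add_mul, sum_add_distrib, alternatingSum]
    congr 1
    simp
  have hle : ∀ x ≤ k, 0 ≤ chooseComb k c x ∧ chooseComb k c x ≤ 2 := by
    intro x hx
    rw [hc, alternatingSum_of_le hx]
    rcases neg_one_pow_eq_or ℤ (k - x) with h | h <;> rw [h] <;> norm_num
  have := le_of_mem_cpaRatios h.le c 2 (fun x _ => ?_) (fun x hx => (hle x hx).2) ?_ hx
  · rw [hc] at this
    exact_mod_cast this
  · rcases le_or_gt x k with hxk | hxk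
    · exact (hle x hxk).1
    · rw [hc]
      linarith [alternatingSum_nonneg hxk]
  · rw [hc]
    linarith [alternatingSum_nonneg h]

theorem le_of_mem_cpaRatios_one {q p : ℕ} (hq : 0 < q) {x : ℝ} (hx : x ∈ cpaRatios q p 1) :
    x ≤ (p : ℝ) / q := by
  have hc : ∀ x, chooseComb 1 (fun i => if i = 1 then 1 else 0) x = x := by
    intro x
    simp [chooseComb]
  have := le_of_mem_cpaRatios hq (fun i => if i = 1 then 1 else 0) p
    (fun x _ => by rw [hc]; positivity) (fun x hx => by rw [hc]; exact_mod_cast hx)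
    (by rw [hc]; exact_mod_cast hq) hx
  rw [hc] at this
  simpa using this

/-- No integer lies strictly between `b` and `a`, so `(x - a)(x - b)` is nonnegative on integers. It
exceeds `a * b` by `x * (x - a - b)`, which is nonpositive on `0, …, a + b`. -/
theorem le_of_mem_cpaRatios_two {q a b : ℕ} (hab : a = b ∨ a = b + 1) (hb : 0 < b)
    (hq : a + b < q) {x : ℝ} (hx : x ∈ cpaRatios q (a + b) 2) :
    x ≤ ((a : ℝ) * b) / (((q : ℝ) - a) * (q - b)) := by
  set c : ℕ → ℤ := fun i => if i = 0 then (a * b : ℤ) else if i = 1 then 1 - a - b else 2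
  have hc : ∀ x, chooseComb 2 c x = ((x : ℤ) - a) * (x - b) := by
    intro x
    have h2 : (2 : ℤ) * (x.choose 2 : ℤ) = x * (x - 1) := by
      have : ((x.choose 2 : ℕ) : ℚ) = x * (x - 1) / 2 := Nat.cast_choose_two ℚ x
      have h3 : (2 : ℚ) * (x.choose 2 : ℕ) = x * (x - 1) := by rw [this]; ring
      exact_mod_cast h3
    simp only [chooseComb, sum_range_succ, c]
    simp only [range_zero, sum_empty, if_true, Nat.choose_zero_right, Nat.choose_one_right,
      one_ne_zero, if_false, OfNat.ofNat_ne_zero, OfNat.ofNat_ne_one, h2]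
    push_cast
    ring
  have := le_of_mem_cpaRatios (by omega) c (a * b) (fun x _ => ?_) (fun x hx => ?_) ?_ hx
  · rw [hc] at this
    exact_mod_cast this
  · rw [hc]
    rcases hab with rfl | rfl
    · exact mul_self_nonneg _
    · rcases le_or_gt x b with h | h
      · exact mul_nonneg_of_nonpos_of_nonpos (by push_cast; omega) (by omega)
      · exact mul_nonneg (by push_cast; omega) (by omega)
  · rw [hc]
    have : (x : ℤ) ≤ a + b := by exact_mod_cast hx
    nlinarith
  · rw [hc]
    exact mul_pos (by omega) (by omega)

/-! ### Strength one: cyclic shifts -/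

theorem exists_mem_arpaRatios_one {q p : ℕ} (hp : 0 < p) (hpq : p ≤ q) :
    ∃ x ∈ arpaRatios q p 1, (p : ℝ) / q ≤ x := by
  have : NeZero q := ⟨by omega⟩
  set Q : Fin q → Fin q → Fin q := fun t j => if t.val < p then j else j - t
  set P : Fin q → Fin q → Fin q := fun r j => if (j - r).val < p then j else r
  refine ⟨_, ratio_mem_arpaRatios_of_multiset ((univ : Finset (Fin q)).val.map Q)
    ((univ : Finset (Fin q)).val.map P) ?_ ?_ ?_, ?_⟩
  · exact Multiset.mem_map.2 ⟨0, mem_univ_val _, by simp [Q, hp]⟩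
  · intro f hf
    obtain ⟨r, -, rfl⟩ := Multiset.mem_map.1 hf
    have hsub : univ.image (P r) ⊆ (univ.filter fun i : Fin q => i.val < p).image (· + r) := by
      intro y hy
      obtain ⟨j, -, rfl⟩ := mem_image.1 hy
      by_cases h : (j - r).val < p
      · exact mem_image.2 ⟨j - r, by simpa using h, by simp [P, h]⟩
      · exact mem_image.2 ⟨0, by simpa using hp, by simp [P, h]⟩
    refine (card_le_card hsub).trans (card_image_le.trans ?_)
    rw [Fin.card_filter_val_lt]
    exact min_le_right _ _
  · intro J hJ v
    obtain ⟨j, rfl⟩ := card_eq_one.1 hJ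
    simp only [mem_singleton, forall_eq, Multiset.countP_map, ← Finset.filter_val]
    change #_ = #_
    -- In column `j`, row `t` of `Q` and row `j - t` of `P` have the same entry.
    refine card_bij' (fun t _ => j - t) (fun r _ => j - r) ?_ ?_ ?_ ?_
    · intro t ht
      simpa [Q, P] using ht
    · intro r hr
      simpa [Q, P] using hr
    · simp
    · simp
  · have h1 : p ≤ ((univ : Finset (Fin q)).val.map Q).count (fun j => j) := by
      rw [Multiset.count_map, ← Finset.filter_val]
      change p ≤ #_
      calc p = #(univ.filter fun i : Fin q => i.val < p) := by
            rw [Fin.card_filter_val_lt, min_eq_right hpq]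
        _ ≤ _ := card_le_card fun t ht => by
            simp only [mem_filter, mem_univ, true_and] at ht ⊢
            simp [Q, ht]
    simp only [Multiset.card_map, card_val, card_univ, Fintype.card_fin]
    gcongr

/-! ### The case `p = k`: recursion on the number of columns -/

/-- The multisets `A` and `B` of maps contain, for each set `J` of at most `k` naturals less than
`q`, equally many maps with any prescribed restriction to `J`. -/
def EquidistributedOn (q k : ℕ) (A B : Multiset (ℕ → ℕ)) : Prop :=
  ∀ J ⊆ range q, #J ≤ k → ∀ v : ℕ → ℕ,
    A.countP (fun f => ∀ j ∈ J, f j = v j) = B.countP (fun f => ∀ j ∈ J, f j = v j)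

/-- `P` and `id ::ₘ N` are the rows of the arrays of a `(q, k)`-alphabet reduction pair of
strength `k`, in a form suited to a recursion on `q`. -/
structure IsReduction (q k : ℕ) (P N : Multiset (ℕ → ℕ)) : Prop where
  lt_left : ∀ f ∈ P, ∀ j < q, f j < q
  lt_right : ∀ f ∈ N, ∀ j < q, f j < q
  card_left : ∀ f ∈ P, #((range q).image f) ≤ k
  card_right : ∀ f ∈ N, #(insert 0 ((range q).image f)) ≤ k + 1
  same : EquidistributedOn q k (id ::ₘ N) P

theorem image_update_range_succ (q y : ℕ) (f : ℕ → ℕ) :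
    (range (q + 1)).image (Function.update f q y) = insert y ((range q).image f) := by
  rw [range_add_one, image_insert, Function.update_self]
  congr 1
  refine image_congr fun j hj => ?_
  rw [Function.update_of_ne]
  have := mem_range.1 (mem_coe.1 hj)
  omega

theorem countP_map_update_of_notMem {q : ℕ} {J : Finset ℕ} (hJ : q ∉ J) (v : ℕ → ℕ)
    (g : (ℕ → ℕ) → ℕ) (A : Multiset (ℕ → ℕ)) :
    (A.map fun f => Function.update f q (g f)).countP (fun f => ∀ j ∈ J, f j = v j) =
      A.countP (fun f => ∀ j ∈ J, f j = v j) := by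
  rw [Multiset.countP_map, ← Multiset.countP_eq_card_filter]
  refine Multiset.countP_congr rfl fun f _ => ?_
  refine propext (forall₂_congr fun j hj => ?_)
  rw [Function.update_of_ne (by rintro rfl; exact hJ hj)]

theorem countP_map_update_insert {q : ℕ} {J : Finset ℕ} (hJ : q ∉ J) (v : ℕ → ℕ)
    (g : (ℕ → ℕ) → ℕ) (A : Multiset (ℕ → ℕ)) :
    (A.map fun f => Function.update f q (g f)).countP (fun f => ∀ j ∈ insert q J, f j = v j) =
      A.countP (fun f => g f = v q ∧ ∀ j ∈ J, f j = v j) := by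
  rw [Multiset.countP_map, ← Multiset.countP_eq_card_filter]
  refine Multiset.countP_congr rfl fun f _ => ?_
  rw [forall_mem_insert, Function.update_self]
  refine propext (and_congr_right fun _ => forall₂_congr fun j hj => ?_)
  rw [Function.update_of_ne (by rintro rfl; exact hJ hj)]

theorem countP_map_update_const_insert {q : ℕ} {J : Finset ℕ} (hJ : q ∉ J) (v : ℕ → ℕ)
    (y : ℕ) (A : Multiset (ℕ → ℕ)) :
    (A.map fun f => Function.update f q y).countP (fun f => ∀ j ∈ insert q J, f j = v j) =
      if y = v q then A.countP (fun f => ∀ j ∈ J, f j = v j) else 0 := by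
  rw [countP_map_update_insert hJ v fun _ => y]
  split_ifs with h <;> simp [h]

/-- This handles a new column that copies column `0`: its prescription becomes one on column `0`. If
that contradicts a prescription already in `J`, both counts are zero. -/
theorem EquidistributedOn.countP_and_zero {q k : ℕ} {A B : Multiset (ℕ → ℕ)}
    (h : EquidistributedOn q k A B) (hq : 0 < q) {J : Finset ℕ} (hJ : J ⊆ range q)
    (hJk : #J + 1 ≤ k) (v : ℕ → ℕ) (y : ℕ) :
    A.countP (fun f => f 0 = y ∧ ∀ j ∈ J, f j = v j) =
      B.countP (fun f => f 0 = y ∧ ∀ j ∈ J, f j = v j) := by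
  by_cases h0 : 0 ∈ J → v 0 = y
  · have := h (insert 0 J) (insert_subset (mem_range.2 hq) hJ) ((card_insert_le _ _).trans hJk)
      (Function.update v 0 y)
    have key : ∀ f : ℕ → ℕ, (∀ j ∈ insert 0 J, f j = Function.update v 0 y j) ↔
        (f 0 = y ∧ ∀ j ∈ J, f j = v j) := by
      intro f
      rw [forall_mem_insert, Function.update_self]
      refine and_congr_right fun _ => forall₂_congr fun j hj => ?_
      rcases eq_or_ne j 0 with rfl | hj0
      · rw [Function.update_self, h0 hj]
      · rw [Function.update_of_ne hj0]
    simpa only [key] using this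
  · push Not at h0
    have key : ∀ f : ℕ → ℕ, ¬ (f 0 = y ∧ ∀ j ∈ J, f j = v j) := fun f hf =>
      h0.2 ((hf.2 0 h0.1).symm.trans hf.1)
    simp [key]

/-- Adding a column: `P₁, N₁` reduce the map that sends `q` to `0` and fixes all `j < q`, while
`P₀, N₀` handle the difference between the identity and this map. -/
theorem IsReduction.step {q k : ℕ} {P₁ N₁ P₀ N₀ : Multiset (ℕ → ℕ)} (hq : 0 < q)
    (h : IsReduction q (k + 1) P₁ N₁)
    (hP₀ : ∀ f ∈ P₀, ∀ j < q, f j < q + 1) (hN₀ : ∀ f ∈ N₀, ∀ j < q, f j < q + 1)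
    (hP₀k : ∀ f ∈ P₀, #(insert q ((range q).image f)) ≤ k + 1)
    (hN₀k : ∀ f ∈ N₀, #(insert 0 ((range q).image f)) ≤ k + 1)
    (h₀ : EquidistributedOn q k (id ::ₘ N₀) P₀) :
    IsReduction (q + 1) (k + 1)
      (P₁.map (fun f => Function.update f q (f 0)) + P₀.map (fun f => Function.update f q q) +
        N₀.map (fun f => Function.update f q 0))
      (N₁.map (fun f => Function.update f q (f 0)) + N₀.map (fun f => Function.update f q q) +
        P₀.map (fun f => Function.update f q 0)) := by
  have hlt : ∀ (f : ℕ → ℕ) (y : ℕ), (∀ j < q, f j < q + 1) → y < q + 1 →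
      ∀ j < q + 1, Function.update f q y j < q + 1 := by
    intro f y hf hy j hj
    rcases eq_or_ne j q with rfl | h
    · simpa using hy
    · rw [Function.update_of_ne h]
      exact hf j (by omega)
  have h0mem : ∀ f : ℕ → ℕ, f 0 ∈ (range q).image f :=
    fun f => mem_image_of_mem f (mem_range.2 hq)
  refine ⟨?_, ?_, ?_, ?_, ?_⟩
  · simp only [Multiset.mem_add, Multiset.mem_map]
    rintro f ((⟨f, hf, rfl⟩ | ⟨f, hf, rfl⟩) | ⟨f, hf, rfl⟩)
    · exact hlt _ _ (fun j hj => (h.lt_left f hf j hj).trans (by omega))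
        ((h.lt_left f hf 0 hq).trans (by omega))
    · exact hlt _ _ (hP₀ f hf) (by omega)
    · exact hlt _ _ (hN₀ f hf) (by omega)
  · simp only [Multiset.mem_add, Multiset.mem_map]
    rintro f ((⟨f, hf, rfl⟩ | ⟨f, hf, rfl⟩) | ⟨f, hf, rfl⟩)
    · exact hlt _ _ (fun j hj => (h.lt_right f hf j hj).trans (by omega))
        ((h.lt_right f hf 0 hq).trans (by omega))
    · exact hlt _ _ (hN₀ f hf) (by omega)
    · exact hlt _ _ (hP₀ f hf) (by omega)
  · simp only [Multiset.mem_add, Multiset.mem_map]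
    rintro f ((⟨f, hf, rfl⟩ | ⟨f, hf, rfl⟩) | ⟨f, hf, rfl⟩) <;> rw [image_update_range_succ]
    · rw [insert_eq_of_mem (h0mem f)]
      exact h.card_left f hf
    · exact hP₀k f hf
    · exact hN₀k f hf
  · simp only [Multiset.mem_add, Multiset.mem_map]
    rintro f ((⟨f, hf, rfl⟩ | ⟨f, hf, rfl⟩) | ⟨f, hf, rfl⟩) <;> rw [image_update_range_succ]
    · rw [insert_eq_of_mem (h0mem f)]
      exact h.card_right f hf
    · rw [insert_comm]
      exact (card_insert_le _ _).trans (Nat.succ_le_succ (hN₀k f hf))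
    · rw [insert_idem]
      exact (card_insert_le _ _).trans (Nat.succ_le_succ
        ((card_le_card (subset_insert _ _)).trans (hP₀k f hf)))
  · intro J hJ hJk v
    -- If `q ∈ J`, only `#J - 1` old columns remain, so strength `k` suffices for `P₀, N₀`. If `q ∉
    -- J`, the copies of `P₀` and `N₀` ending in `q` and in `0` cancel.
    by_cases hqJ : q ∈ J
    · obtain ⟨K, hqK, rfl⟩ : ∃ K, q ∉ K ∧ insert q K = J :=
        ⟨J.erase q, notMem_erase _ _, insert_erase hqJ⟩
      rw [card_insert_of_notMem hqK] at hJk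
      have hK : K ⊆ range q := by
        intro j hj
        have h1 := mem_range.1 (hJ (mem_insert_of_mem hj))
        have h2 : j ≠ q := by rintro rfl; exact hqK hj
        exact mem_range.2 (by omega)
      have e1 := h.same.countP_and_zero hq hK hJk v (v q)
      have e2 := h₀ K hK (by omega) v
      have e3 := countP_map_update_insert hqK v (fun f => f 0)
      simp only [Multiset.countP_add, Multiset.countP_cons, countP_map_update_const_insert hqK, e3]
        at e1 e2 ⊢
      simp only [forall_mem_insert, id] at e1 e2 ⊢
      rcases Classical.propComplete (∀ j ∈ K, j = v j) with hid | hid <;>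
      rcases Classical.propComplete (0 = v q) with hv0 | hv0 <;>
      rcases Classical.propComplete (q = v q) with hvq | hvq <;>
      simp only [hid, hv0, hvq, and_true, and_false, if_true, if_false] at e1 e2 ⊢ <;>
      omega
    · have hK : J ⊆ range q := by
        intro j hj
        have h1 := mem_range.1 (hJ hj)
        have h2 : j ≠ q := by rintro rfl; exact hqJ hj
        exact mem_range.2 (by omega)
      have e1 := h.same J hK hJk v
      have e2 := countP_map_update_of_notMem hqJ v (fun f => f 0)
      have e3 := fun y => countP_map_update_of_notMem hqJ v (fun _ => y)
      simp only [Multiset.countP_add, Multiset.countP_cons, e2, e3] at e1 ⊢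
      omega

theorem EquidistributedOn.card_eq {q k : ℕ} {A B : Multiset (ℕ → ℕ)}
    (h : EquidistributedOn q k A B) : Multiset.card A = Multiset.card B := by
  simpa using h ∅ (by simp) (by simp) id

/-- Apply `IsReduction.step` to pairs of strengths `k + 1` and `k` on `q` columns. The bound
`card_right` is what lets the rows of `N₀`, extended by `0`, join the new `P`. As `N₀` has one row
fewer than `P₀`, together they contribute `alternatingSum q k` rows. -/
theorem exists_isReduction (k q : ℕ) (hkq : k + 1 ≤ q) :
    ∃ P N, IsReduction q (k + 1) P N ∧
      2 * (Multiset.card P : ℤ) = 1 + alternatingSum q (k + 1) := by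
  induction q generalizing k with
  | zero => omega
  | succ q ih =>
    rcases hkq.eq_or_lt with hk | hk
    · refine ⟨{id}, 0, ⟨?_, ?_, ?_, ?_, ?_⟩, ?_⟩
      · simp
      · simp
      · simpa using hk.ge
      · simp
      · exact fun J _ _ v => rfl
      · rw [← hk, alternatingSum_of_le le_rfl]
        simp
    obtain ⟨P₁, N₁, h₁, hc₁⟩ := ih k (by omega)
    cases k with
    | zero =>
      -- At strength `0` only the number of rows matters, so one constant row balances the identity;
      -- the value `q` keeps a single symbol once column `q` is added.
      refine ⟨_, _, h₁.step (P₀ := {fun _ => q}) (N₀ := 0) (by omega) (by simp) (by simp) ?_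
        (by simp) ?_, ?_⟩
      · intro f hf
        obtain rfl := Multiset.mem_singleton.1 hf
        refine (card_le_card (t := {q}) ?_).trans (by simp)
        intro x
        simp only [mem_insert, mem_image, mem_singleton]
        rintro (h | ⟨_, _, h⟩) <;> exact h.symm ▸ rfl
      · intro J _ hJ v
        obtain rfl := card_eq_zero.1 (Nat.le_zero.1 hJ)
        simp
      · rw [alternatingSum_succ, alternatingSum_zero]
        simp only [Multiset.card_add, Multiset.card_map, Multiset.card_singleton,
          Multiset.card_zero]
        push_cast
        linarith
    | succ k =>
      obtain ⟨P₀, N₀, h₀, hc₀⟩ := ih k (by omega)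
      refine ⟨_, _, h₁.step (by omega) (fun f hf j hj => (h₀.lt_left f hf j hj).trans (by omega))
        (fun f hf j hj => (h₀.lt_right f hf j hj).trans (by omega))
        (fun f hf => (card_insert_le _ _).trans (Nat.succ_le_succ (h₀.card_left f hf)))
        h₀.card_right h₀.same, ?_⟩
      have h2 := h₀.same.card_eq
      rw [alternatingSum_succ]
      simp only [Multiset.card_add, Multiset.card_map, Multiset.card_cons] at h2 ⊢
      rw [← h2] at hc₀ ⊢
      push_cast at *
      linarith

theorem exists_mem_arpaRatios_self {k q : ℕ} (hk : 0 < k) (hkq : k < q) :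
    ∃ x ∈ arpaRatios q k k, 2 / (1 + alternatingSum q k : ℝ) ≤ x := by
  obtain ⟨k, rfl⟩ : ∃ m, k = m + 1 := ⟨k - 1, by omega⟩
  obtain ⟨P, N, h, hc⟩ := exists_isReduction k q hkq.le
  have : NeZero q := ⟨by omega⟩
  set e : (ℕ → ℕ) → Fin q → Fin q := fun f j => Fin.ofNat q (f j)
  have he : ∀ f : ℕ → ℕ, (∀ j < q, f j < q) → ∀ j, (e f j).val = f j := by
    intro f hf j
    simp [e, Nat.mod_eq_of_lt (hf j j.isLt)]
  have hid : e id = fun j => j := by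
    ext j
    rw [he id fun j hj => hj]
    rfl
  refine ⟨_, ratio_mem_arpaRatios_of_multiset ((id ::ₘ N).map e) (P.map e) ?_ ?_ ?_, ?_⟩
  · exact Multiset.mem_map.2 ⟨id, Multiset.mem_cons_self _ _, hid⟩
  · intro f' hf'
    obtain ⟨f, hf, rfl⟩ := Multiset.mem_map.1 hf'
    refine le_trans ?_ (h.card_left f hf)
    rw [← card_map Fin.valEmbedding]
    refine card_le_card fun x hx => ?_
    obtain ⟨y, hy, rfl⟩ := mem_map.1 hx
    obtain ⟨j, -, rfl⟩ := mem_image.1 hy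
    exact mem_image.2 ⟨j, mem_range.2 j.isLt, (he f (h.lt_left f hf) j).symm⟩
  · intro J hJ v
    have key : ∀ A : Multiset (ℕ → ℕ), (∀ f ∈ A, ∀ j < q, f j < q) →
        (A.map e).countP (fun f => ∀ j ∈ J, f j = v j) =
          A.countP (fun f => ∀ j ∈ J.map Fin.valEmbedding, f j = (v (Fin.ofNat q j)).val) := by
      intro A hA
      rw [Multiset.countP_map, ← Multiset.countP_eq_card_filter]
      refine Multiset.countP_congr rfl fun f hf => propext ?_
      simp only [forall_mem_map, Fin.valEmbedding_apply, Fin.ofNat_eq_cast, Fin.cast_val_eq_self,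
        Fin.ext_iff, he f (hA f hf)]
    rw [key _ h.lt_left, key]
    · refine h.same _ ?_ ?_ fun j => (v (Fin.ofNat q j)).val
      · intro x hx
        obtain ⟨y, -, rfl⟩ := mem_map.1 hx
        exact mem_range.2 y.isLt
      · rw [card_map, hJ]
    · intro f hf
      rcases Multiset.mem_cons.1 hf with rfl | hf
      · exact fun j hj => hj
      · exact h.lt_right f hf
  · have h1 : 1 ≤ ((id ::ₘ N).map e).count fun j => j :=
      Multiset.one_le_count_iff_mem.2 (Multiset.mem_map.2 ⟨id, Multiset.mem_cons_self _ _, hid⟩)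
    have hc' : 2 * (Multiset.card P : ℝ) = 1 + alternatingSum q (k + 1) := by exact_mod_cast hc
    rw [← hc', Multiset.card_map, div_mul_cancel_left₀ two_ne_zero, inv_eq_one_div]
    gcongr
    exact_mod_cast h1

/-! ### Strength two: averaging over permutations -/

/-- Sums over all permutations of a function of the images of two points. -/
theorem Equiv.Perm.sum_apply_apply_eq_zero {n : ℕ} (G : Fin n → Fin n → ℤ)
    (hG : ∑ i, ∑ j, G i j = ∑ i, G i i) {s t : Fin n} (hst : s ≠ t) :
    ∑ σ : Equiv.Perm (Fin n), G (σ s) (σ t) = 0 := by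
  have hG' : ∑ x ∈ (univ : Finset (Fin n)).offDiag, G x.1 x.2 = 0 := by
    have h := sum_union (f := fun x => G x.1 x.2)
      (disjoint_diag_offDiag (univ : Finset (Fin n)))
    rw [diag_union_offDiag, sum_product, sum_diag] at h
    linarith
  -- Permutations act transitively on ordered pairs of distinct points, so the sum is the same for
  -- every such pair; by `hG'` the total over these pairs is zero.
  have htrans : ∀ x ∈ (univ : Finset (Fin n)).offDiag,
      ∑ σ : Equiv.Perm (Fin n), G (σ x.1) (σ x.2) = ∑ σ : Equiv.Perm (Fin n), G (σ s) (σ t) := by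
    rintro ⟨i, j⟩ hx
    have hij : i ≠ j := by simpa using hx
    obtain ⟨τ, rfl, rfl⟩ : ∃ τ : Equiv.Perm (Fin n), τ s = i ∧ τ t = j := by
      have hne : Equiv.swap s i t ≠ i := fun h =>
        hst ((Equiv.swap s i).injective ((Equiv.swap_apply_left s i).trans h.symm))
      refine ⟨(Equiv.swap s i).trans (Equiv.swap (Equiv.swap s i t) j), ?_, ?_⟩
      · rw [Equiv.trans_apply, Equiv.swap_apply_left, Equiv.swap_apply_of_ne_of_ne hne.symm hij]
      · rw [Equiv.trans_apply, Equiv.swap_apply_left]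
    exact Fintype.sum_equiv (Equiv.mulRight τ) _ _ fun σ => rfl
  have h1 : #(univ : Finset (Fin n)).offDiag • ∑ σ : Equiv.Perm (Fin n), G (σ s) (σ t) = 0 := by
    rw [← sum_const, ← sum_congr rfl htrans, sum_comm]
    refine sum_eq_zero fun σ _ => ?_
    rw [← hG']
    refine sum_bij' (fun x _ => (σ x.1, σ x.2)) (fun x _ => (σ.symm x.1, σ.symm x.2)) ?_ ?_ ?_ ?_ ?_
      <;> simp
  rcases smul_eq_zero.1 h1 with h | h
  · exact absurd (card_eq_zero.1 h) (ne_empty_of_mem (a := (s, t)) (by simpa using hst))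
  · exact h

theorem Equiv.Perm.sum_apply_eq_zero {n : ℕ} (G : Fin n → ℤ) (hG : ∑ i, G i = 0) (s : Fin n) :
    ∑ σ : Equiv.Perm (Fin n), G (σ s) = 0 := by
  have htrans : ∀ i, ∑ σ : Equiv.Perm (Fin n), G (σ i) = ∑ σ : Equiv.Perm (Fin n), G (σ s) :=
    fun i => Fintype.sum_equiv (Equiv.mulRight (Equiv.swap s i)) _ _ fun σ => by simp
  have h1 : #(univ : Finset (Fin n)) • ∑ σ : Equiv.Perm (Fin n), G (σ s) = 0 := by
    rw [← sum_const, ← sum_congr rfl fun i _ => htrans i,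
      sum_comm]
    refine sum_eq_zero fun σ _ => ?_
    rw [← hG]
    exact Equiv.sum_comp σ G
  rcases smul_eq_zero.1 h1 with h | h
  · exact absurd (card_eq_zero.1 h) (ne_empty_of_mem (mem_univ s))
  · exact h

theorem sum_fin_ite_lt {n u : ℕ} (hu : u ≤ n) :
    ∑ i : Fin n, (if i.val < u then (1 : ℤ) else 0) = u := by
  rw [sum_boole, Fin.card_filter_val_lt, min_eq_right hu]

theorem sum_fin_ite_lt_mul {n u v : ℕ} (hu : u ≤ n) (huv : u ≤ v) :
    ∑ i : Fin n, (if i.val < u then (1 : ℤ) else 0) * (if i.val < v then (1 : ℤ) else 0) = u := by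
  rw [← sum_fin_ite_lt hu]
  refine sum_congr rfl fun i _ => ?_
  by_cases h : i.val < u
  · simp [h, h.trans_le huv]
  · simp [h]

/-- The row that keeps the coefficient of column `s + 1` if `σ s` satisfies `I`, and otherwise
replaces it with `y (σ s)`; the coefficient of column `0` is `c`. -/
def maskedRow {n : ℕ} (σ : Equiv.Perm (Fin n)) (I : Fin n → Prop) [DecidablePred I]
    (c : Fin (n + 1)) (y : Fin n → Fin (n + 1)) : Fin (n + 1) → Fin (n + 1) :=
  Fin.cases c fun s => if I (σ s) then s.succ else y (σ s)

/-- The row that keeps column `0` and the first `u` columns for the order `σ`, and is `0`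
elsewhere. -/
def prefixRow {n : ℕ} (σ : Equiv.Perm (Fin n)) (u : ℕ) : Fin (n + 1) → Fin (n + 1) :=
  maskedRow σ (fun i => i.val < u) 0 fun _ => 0

/-- The row that keeps the columns selected by `I`, is `0` on the other ones among the first `p`
columns for the order `σ`, and equal to the first of these columns elsewhere. -/
def blockRow {n : ℕ} [NeZero n] (σ : Equiv.Perm (Fin n)) (p : ℕ) (I : Fin n → Prop)
    [DecidablePred I] : Fin (n + 1) → Fin (n + 1) :=
  maskedRow σ I (σ.symm 0).succ fun i => if i.val < p then 0 else (σ.symm 0).succ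

theorem card_image_le_of_forall {n u : ℕ} (σ : Equiv.Perm (Fin n)) (z : Fin (n + 1))
    (f : Fin (n + 1) → Fin (n + 1)) (hf : ∀ j, f j = z ∨ ∃ s, f j = Fin.succ s ∧ (σ s).val < u) :
    #(univ.image f) ≤ u + 1 := by
  have hsub : univ.image f ⊆
      insert z ((univ.filter fun i : Fin n => i.val < u).image fun i => (σ.symm i).succ) := by
    intro x hx
    obtain ⟨j, -, rfl⟩ := mem_image.1 hx
    rcases hf j with h | ⟨s, h, hs⟩
    · rw [h]
      exact mem_insert_self _ _
    · rw [h]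
      exact mem_insert_of_mem (mem_image.2 ⟨σ s, by simpa using hs, by simp⟩)
  refine (card_le_card hsub).trans ((card_insert_le _ _).trans (Nat.succ_le_succ
    (card_image_le.trans ?_)))
  rw [Fin.card_filter_val_lt]
  exact min_le_right _ _

theorem card_image_prefixRow_le {n : ℕ} (σ : Equiv.Perm (Fin n)) (u : ℕ) :
    #(univ.image (prefixRow σ u)) ≤ u + 1 := by
  refine card_image_le_of_forall σ 0 _ fun j => ?_
  refine Fin.cases (Or.inl rfl) (fun s => ?_) j
  by_cases h : (σ s).val < u
  · exact Or.inr ⟨s, by simp [prefixRow, maskedRow, h], h⟩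
  · exact Or.inl (by simp [prefixRow, maskedRow, h])

theorem card_image_blockRow_full_le {n p : ℕ} [NeZero n] (σ : Equiv.Perm (Fin n)) (hp : 0 < p) :
    #(univ.image (blockRow σ p fun i => i.val < p)) ≤ p := by
  have hsub : univ.image (blockRow σ p fun i => i.val < p) ⊆
      (univ.filter fun i : Fin n => i.val < p).image fun i => (σ.symm i).succ := by
    intro x hx
    obtain ⟨j, -, rfl⟩ := mem_image.1 hx
    refine Fin.cases (mem_image.2 ⟨0, by simpa using hp, rfl⟩) (fun s => ?_) j
    by_cases h : (σ s).val < p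
    · exact mem_image.2 ⟨σ s, by simpa using h, by simp [blockRow, maskedRow, h]⟩
    · exact mem_image.2 ⟨0, by simpa using hp, by simp [blockRow, maskedRow, h]⟩
  refine (card_le_card hsub).trans (card_image_le.trans ?_)
  rw [Fin.card_filter_val_lt]
  exact min_le_right _ _

theorem card_image_blockRow_empty_le {n p : ℕ} [NeZero n] (σ : Equiv.Perm (Fin n)) :
    #(univ.image (blockRow σ p fun _ => False)) ≤ 2 := by
  have hsub : univ.image (blockRow σ p fun _ => False) ⊆ {0, (σ.symm 0).succ} := by
    intro x hx
    obtain ⟨j, -, rfl⟩ := mem_image.1 hx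
    refine Fin.cases (by simp [blockRow, maskedRow]) (fun s => ?_) j
    by_cases h : (σ s).val < p <;> simp [blockRow, maskedRow, h]
  exact (card_le_card hsub).trans card_le_two

theorem prefixRow_pair {n : ℕ} (σ : Equiv.Perm (Fin n)) (u : ℕ)
    (φ : Fin (n + 1) → Fin (n + 1) → ℤ) (s t : Fin n) :
    φ (prefixRow σ u s.succ) (prefixRow σ u t.succ) = φ 0 0 +
      (φ s.succ 0 - φ 0 0) * (if (σ s).val < u then 1 else 0) +
      (φ 0 t.succ - φ 0 0) * (if (σ t).val < u then 1 else 0) +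
      (φ s.succ t.succ - φ s.succ 0 - φ 0 t.succ + φ 0 0) *
        ((if (σ s).val < u then 1 else 0) * (if (σ t).val < u then 1 else 0)) := by
  by_cases h1 : (σ s).val < u <;> by_cases h2 : (σ t).val < u <;>
    simp only [prefixRow, maskedRow, Fin.cases_succ, h1, h2, if_true, if_false] <;> ring

/-- Entries at positions from `p` on do not depend on the selected set, and single-column
contributions cancel since `[0, a)` and `[a, p)` partition `[0, p)`. What survives is the mixed
difference of `φ`, when one column lies in each part. -/
theorem blockRow_pair {n : ℕ} [NeZero n] (σ : Equiv.Perm (Fin n)) {a p : ℕ} (hap : a ≤ p)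
    (φ : Fin (n + 1) → Fin (n + 1) → ℤ) (s t : Fin n) :
    φ (blockRow σ p (fun i => i.val < p) s.succ) (blockRow σ p (fun i => i.val < p) t.succ) +
      φ (blockRow σ p (fun _ => False) s.succ) (blockRow σ p (fun _ => False) t.succ) -
      φ (blockRow σ p (fun i => i.val < a) s.succ) (blockRow σ p (fun i => i.val < a) t.succ) -
      φ (blockRow σ p (fun i => a ≤ i.val ∧ i.val < p) s.succ)
        (blockRow σ p (fun i => a ≤ i.val ∧ i.val < p) t.succ) =
      (φ s.succ t.succ - φ s.succ 0 - φ 0 t.succ + φ 0 0) *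
        ((if (σ s).val < a then 1 else 0) * (if (σ t).val < p then 1 else 0) +
         (if (σ t).val < a then 1 else 0) * (if (σ s).val < p then 1 else 0) -
         2 * ((if (σ s).val < a then 1 else 0) * (if (σ t).val < a then 1 else 0))) := by
  have key : ∀ i : Fin n, (i.val < a ∧ i.val < p ∧ ¬ a ≤ i.val) ∨
      (¬ i.val < a ∧ i.val < p ∧ a ≤ i.val) ∨ (¬ i.val < a ∧ ¬ i.val < p ∧ a ≤ i.val) := by
    intro i
    omega
  rcases key (σ s) with ⟨h1, h2, h3⟩ | ⟨h1, h2, h3⟩ | ⟨h1, h2, h3⟩ <;>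
  rcases key (σ t) with ⟨h4, h5, h6⟩ | ⟨h4, h5, h6⟩ | ⟨h4, h5, h6⟩ <;>
  simp only [blockRow, maskedRow, Fin.cases_succ, h1, h2, h3, h4, h5, h6, if_true, if_false,
    and_true, and_false, and_self] <;> ring

/-- The signed sum of `φ` over the rows of the pair of strength `2` derived from `σ`, at the
columns `s` and `t`. Here `n = a + 1 + b + d`. -/
def pairDefect {n : ℕ} [NeZero n] (a b d : ℕ) (φ : Fin (n + 1) → Fin (n + 1) → ℤ)
    (s t : Fin (n + 1)) (σ : Equiv.Perm (Fin n)) : ℤ :=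
  2 * (a + 1) * (b + d + 1) * φ (prefixRow σ (a + b) s) (prefixRow σ (a + b) t) +
    (b + d + 1) * (d + 1) *
      (φ (blockRow σ (a + 1 + b) (fun i => i.val < a + 1 + b) s)
          (blockRow σ (a + 1 + b) (fun i => i.val < a + 1 + b) t) +
        φ (blockRow σ (a + 1 + b) (fun _ => False) s)
          (blockRow σ (a + 1 + b) (fun _ => False) t) -
        φ (blockRow σ (a + 1 + b) (fun i => i.val < a + 1) s)
          (blockRow σ (a + 1 + b) (fun i => i.val < a + 1) t) -
        φ (blockRow σ (a + 1 + b) (fun i => a + 1 ≤ i.val ∧ i.val < a + 1 + b) s)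
          (blockRow σ (a + 1 + b) (fun i => a + 1 ≤ i.val ∧ i.val < a + 1 + b) t)) -
    2 * (a + 1) * b * φ s t -
    2 * (a + 1) * (d + 1) * φ (prefixRow σ a s) (prefixRow σ a t)

theorem sum_pairDefect_zero {n a b d : ℕ} [NeZero n] (hn : n = a + 1 + b + d)
    (φ : Fin (n + 1) → Fin (n + 1) → ℤ) (t : Fin n) :
    ∑ σ, pairDefect a b d φ 0 t.succ σ = 0 := by
  have hp : ∀ (σ : Equiv.Perm (Fin n)) (u : ℕ),
      φ (prefixRow σ u 0) (prefixRow σ u t.succ) =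
        φ 0 0 + (φ 0 t.succ - φ 0 0) * (if (σ t).val < u then 1 else 0) := by
    intro σ u
    by_cases h : (σ t).val < u <;> simp [prefixRow, maskedRow, h]
  have hb : ∀ σ : Equiv.Perm (Fin n),
      φ (blockRow σ (a + 1 + b) (fun i => i.val < a + 1 + b) 0)
          (blockRow σ (a + 1 + b) (fun i => i.val < a + 1 + b) t.succ) +
        φ (blockRow σ (a + 1 + b) (fun _ => False) 0)
          (blockRow σ (a + 1 + b) (fun _ => False) t.succ) -
        φ (blockRow σ (a + 1 + b) (fun i => i.val < a + 1) 0)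
          (blockRow σ (a + 1 + b) (fun i => i.val < a + 1) t.succ) -
        φ (blockRow σ (a + 1 + b) (fun i => a + 1 ≤ i.val ∧ i.val < a + 1 + b) 0)
          (blockRow σ (a + 1 + b) (fun i => a + 1 ≤ i.val ∧ i.val < a + 1 + b) t.succ) = 0 := by
    intro σ
    have key : ((σ t).val < a + 1 ∧ (σ t).val < a + 1 + b ∧ ¬ a + 1 ≤ (σ t).val) ∨
        (¬ (σ t).val < a + 1 ∧ (σ t).val < a + 1 + b ∧ a + 1 ≤ (σ t).val) ∨
        (¬ (σ t).val < a + 1 ∧ ¬ (σ t).val < a + 1 + b ∧ a + 1 ≤ (σ t).val) := by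
      omega
    rcases key with ⟨h1, h2, h3⟩ | ⟨h1, h2, h3⟩ | ⟨h1, h2, h3⟩ <;>
    simp only [blockRow, maskedRow, Fin.cases_succ, Fin.cases_zero, h1, h2, h3, if_true, if_false,
      and_true, and_false] <;> ring
  simp only [pairDefect, hp, hb]
  -- The four block rows cancel here, so only the weights of the identity and of the two prefix rows
  -- must balance.
  refine Equiv.Perm.sum_apply_eq_zero (fun i : Fin n =>
    2 * (a + 1) * (b + d + 1) * (φ 0 0 + (φ 0 t.succ - φ 0 0) *
      (if i.val < a + b then 1 else 0)) + (b + d + 1) * (d + 1) * 0 -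
    2 * (a + 1) * b * φ 0 t.succ -
    2 * (a + 1) * (d + 1) * (φ 0 0 + (φ 0 t.succ - φ 0 0) * (if i.val < a then 1 else 0))) ?_ t
  simp only [sum_add_distrib, sum_sub_distrib, ← mul_sum, sum_const, card_univ, Fintype.card_fin,
    nsmul_eq_mul, sum_fin_ite_lt (show a + b ≤ n by omega), sum_fin_ite_lt (show a ≤ n by omega)]
  subst hn
  push_cast
  ring

theorem sum_pairDefect_succ {n a b d : ℕ} [NeZero n] (hn : n = a + 1 + b + d)
    (φ : Fin (n + 1) → Fin (n + 1) → ℤ) {s t : Fin n} (hst : s ≠ t) :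
    ∑ σ, pairDefect a b d φ s.succ t.succ σ = 0 := by
  simp only [pairDefect, prefixRow_pair,
    blockRow_pair (φ := φ) (a := a + 1) (p := a + 1 + b) _ (by omega)]
  set e : ℕ → Fin n → ℤ := fun u i => if i.val < u then 1 else 0 with he
  have hsum : ∀ {u}, u ≤ n → ∑ i, e u i = u := fun hu => sum_fin_ite_lt hu
  have hmul : ∀ {u v}, u ≤ n → u ≤ v → ∑ i, e u i * e v i = u :=
    fun hu huv => sum_fin_ite_lt_mul hu huv
  generalize φ s.succ t.succ = φst
  generalize φ s.succ 0 = φs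
  generalize φ 0 t.succ = φt
  generalize φ 0 0 = φ0
  have := Equiv.Perm.sum_apply_apply_eq_zero (fun i j : Fin n =>
    2 * (a + 1) * (b + d + 1) * (φ0 + (φs - φ0) * e (a + b) i + (φt - φ0) * e (a + b) j +
      (φst - φs - φt + φ0) * (e (a + b) i * e (a + b) j)) +
    (b + d + 1) * (d + 1) * ((φst - φs - φt + φ0) *
      (e (a + 1) i * e (a + 1 + b) j + e (a + 1) j * e (a + 1 + b) i -
        2 * (e (a + 1) i * e (a + 1) j))) -
    2 * (a + 1) * b * φst -
    2 * (a + 1) * (d + 1) * (φ0 + (φs - φ0) * e a i + (φt - φ0) * e a j +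
      (φst - φs - φt + φ0) * (e a i * e a j))) ?_ hst
  · exact this
  · simp only [sum_add_distrib, sum_sub_distrib, ← mul_sum, ← sum_mul, sum_const, card_univ,
      Fintype.card_fin, nsmul_eq_mul, hsum (show a + b ≤ n by omega), hsum (show a ≤ n by omega),
      hsum (show a + 1 ≤ n by omega), hsum (show a + 1 + b ≤ n by omega),
      hmul (show a + b ≤ n by omega) le_rfl, hmul (show a ≤ n by omega) le_rfl,
      hmul (show a + 1 ≤ n by omega) le_rfl,
      hmul (show a + 1 ≤ n by omega) (show a + 1 ≤ a + 1 + b by omega)]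
    subst hn
    push_cast
    ring

theorem sum_pairDefect {n a b d : ℕ} [NeZero n] (hn : n = a + 1 + b + d)
    (φ : Fin (n + 1) → Fin (n + 1) → ℤ) {s t : Fin (n + 1)} (hst : s ≠ t) :
    ∑ σ, pairDefect a b d φ s t σ = 0 := by
  induction s using Fin.cases with
  | zero =>
    obtain ⟨t, rfl⟩ := Fin.exists_succ_eq_of_ne_zero hst.symm
    exact sum_pairDefect_zero hn φ t
  | succ s =>
    induction t using Fin.cases with
    -- Exchanging the two columns amounts to exchanging the arguments of `φ`.
    | zero => exact sum_pairDefect_zero hn (fun x y => φ y x) s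
    | succ t => exact sum_pairDefect_succ hn φ fun h => hst (congrArg _ h)

/-- Each permutation contributes at least `2ab` identity rows to `Q` and exactly `2(q - a)(q - b)`
rows to `P`. The other rows of `Q` keep `a` or `b` columns, the roots of the dual polynomial; those
of `P` keep `a + b` or none, where it equals `ab`. -/
theorem exists_mem_arpaRatios_two {q a b : ℕ} (ha : 0 < a) (hb : 0 < b) (hq : a + b < q) :
    ∃ x ∈ arpaRatios q (a + b) 2, ((a : ℝ) * b) / (((q : ℝ) - a) * (q - b)) ≤ x := by
  obtain ⟨a, rfl⟩ : ∃ m, a = m + 1 := ⟨a - 1, by omega⟩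
  -- After the shift of `a`, the weights `b + d + 1` and `d + 1` are `q - a` and `q - p` for the
  -- original `a` and `p = a + b`.
  obtain ⟨d, rfl⟩ : ∃ d, q = a + 1 + b + d + 1 := ⟨q - (a + 1 + b) - 1, by omega⟩
  obtain ⟨n, hn⟩ : ∃ n, n = a + 1 + b + d := ⟨_, rfl⟩
  rw [← hn]
  have : NeZero n := ⟨by omega⟩
  set Q : Equiv.Perm (Fin n) → Multiset (Fin (n + 1) → Fin (n + 1)) := fun σ =>
    (2 * (a + 1) * b) • {fun j => j} + ((2 * (a + 1) * (d + 1)) • {prefixRow σ a} +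
      ((b + d + 1) * (d + 1)) • ({blockRow σ (a + 1 + b) fun i => i.val < a + 1} +
        {blockRow σ (a + 1 + b) fun i => a + 1 ≤ i.val ∧ i.val < a + 1 + b})) with hQ
  set P : Equiv.Perm (Fin n) → Multiset (Fin (n + 1) → Fin (n + 1)) := fun σ =>
    (2 * (a + 1) * (b + d + 1)) • {prefixRow σ (a + b)} +
      ((b + d + 1) * (d + 1)) • ({blockRow σ (a + 1 + b) fun i => i.val < a + 1 + b} +
        {blockRow σ (a + 1 + b) fun _ => False}) with hP
  have hcount : #(univ : Finset (Equiv.Perm (Fin n))) * (2 * (a + 1) * b) ≤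
      (∑ σ, Q σ).count fun j => j := by
    rw [Multiset.count_sum', ← smul_eq_mul]
    refine card_nsmul_le_sum _ _ _ fun σ _ => ?_
    rw [hQ, Multiset.count_add, Multiset.count_nsmul, Multiset.count_singleton_self]
    omega
  have hcard : Multiset.card (∑ σ, P σ) = #(univ : Finset (Equiv.Perm (Fin n))) *
      (2 * (b + d + 1) * (a + d + 2)) := by
    rw [Multiset.card_sum, ← smul_eq_mul, ← sum_const]
    refine sum_congr rfl fun σ _ => ?_
    simp only [hP, Multiset.card_add, Multiset.card_nsmul, Multiset.card_singleton]
    ring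
  have hpos : 0 < #(univ : Finset (Equiv.Perm (Fin n))) := card_pos.2 univ_nonempty
  refine ⟨_, ratio_mem_arpaRatios_of_multiset (∑ σ, Q σ) (∑ σ, P σ) ?_ ?_ ?_, ?_⟩
  · refine Multiset.count_pos.1 (lt_of_lt_of_le ?_ hcount)
    positivity
  · intro f hf
    obtain ⟨σ, -, hf⟩ := Multiset.mem_sum.1 hf
    simp only [hP, Multiset.mem_add, Multiset.mem_nsmul, Multiset.mem_singleton] at hf
    rcases hf with ⟨-, rfl⟩ | ⟨-, rfl | rfl⟩
    · exact (card_image_prefixRow_le σ _).trans (by omega)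
    · exact card_image_blockRow_full_le σ (by omega)
    · exact (card_image_blockRow_empty_le σ).trans (by omega)
  · intro J hJ v
    obtain ⟨s, t, hst, rfl⟩ := card_eq_two.1 hJ
    have h := sum_pairDefect hn (fun x y => if x = v s ∧ y = v t then 1 else 0) hst
    have hsum : ∀ (p : (Fin (n + 1) → Fin (n + 1)) → Prop) [DecidablePred p]
        (A : Equiv.Perm (Fin n) → Multiset (Fin (n + 1) → Fin (n + 1))),
        (∑ σ, A σ).countP p = ∑ σ, (A σ).countP p := fun p _ A =>
      map_sum (Multiset.countPAddMonoidHom p) A univ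
    have hsing : ∀ (p : (Fin (n + 1) → Fin (n + 1)) → Prop) [DecidablePred p]
        (f : Fin (n + 1) → Fin (n + 1)), Multiset.countP p {f} = if p f then 1 else 0 := by
      intro p _ f
      rw [← Multiset.cons_zero, Multiset.countP_cons, Multiset.countP_zero, zero_add]
    simp only [forall_mem_insert, mem_singleton, forall_eq]
    rw [hsum, hsum]
    zify
    rw [← sub_eq_zero, ← sum_sub_distrib, ← neg_eq_zero, ← sum_neg_distrib, ← h]
    refine sum_congr rfl fun σ _ => ?_
    simp only [hP, hQ, Multiset.countP_add, Multiset.countP_nsmul, hsing, pairDefect]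
    push_cast
    ring
  · have hcount' : (#(univ : Finset (Equiv.Perm (Fin n))) : ℝ) * (2 * (a + 1) * b) ≤
        (((∑ σ, Q σ).count fun j => j : ℕ) : ℝ) := by exact_mod_cast hcount
    have hpos' : (0 : ℝ) < #(univ : Finset (Equiv.Perm (Fin n))) := by exact_mod_cast hpos
    rw [hcard]
    refine le_trans (le_of_eq ?_) (div_le_div_of_nonneg_right hcount' (Nat.cast_nonneg _))
    have e1 : ((n + 1 : ℕ) : ℝ) - ((a + 1 : ℕ) : ℝ) = b + d + 1 := by
      rw [hn]; push_cast; ring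
    have e2 : ((n + 1 : ℕ) : ℝ) - (b : ℝ) = a + d + 2 := by
      rw [hn]; push_cast; ring
    rw [e1, e2]
    push_cast
    field_simp

/-! ### The three maxima and the conclusion -/

theorem isGreatest_two {p q : ℕ} (hp : 2 ≤ p) (hpq : p < q) :
    IsGreatest (arpaRatios q p 2) (((⌈(p : ℝ) / 2⌉ : ℝ) * (⌊(p : ℝ) / 2⌋ : ℝ)) /
        (((q : ℝ) - (⌈(p : ℝ) / 2⌉ : ℝ)) * ((q : ℝ) - (⌊(p : ℝ) / 2⌋ : ℝ)))) ∧
    IsGreatest (cpaRatios q p 2) (((⌈(p : ℝ) / 2⌉ : ℝ) * (⌊(p : ℝ) / 2⌋ : ℝ)) /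
        (((q : ℝ) - (⌈(p : ℝ) / 2⌉ : ℝ)) * ((q : ℝ) - (⌊(p : ℝ) / 2⌋ : ℝ)))) := by
  obtain ⟨a, b, hab, rfl⟩ : ∃ a b, (a = b ∨ a = b + 1) ∧ p = a + b :=
    ⟨(p + 1) / 2, p / 2, by omega, by omega⟩
  have hfl : ⌊((a + b : ℕ) : ℝ) / 2⌋ = b := by
    rw [Int.floor_eq_iff]
    rcases hab with rfl | rfl <;> push_cast <;> constructor <;> linarith
  have hce : ⌈((a + b : ℕ) : ℝ) / 2⌉ = a := by
    rw [Int.ceil_eq_iff]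
    rcases hab with rfl | rfl <;> push_cast <;> constructor <;> linarith
  rw [hfl, hce]
  push_cast
  exact isGreatest_of_attained
    (fun x hx => le_of_mem_cpaRatios_two hab (by omega) hpq hx)
    (exists_mem_arpaRatios_two (by omega) (by omega) hpq)

theorem isGreatest_self {k q : ℕ} (hk : 0 < k) (hkq : k < q) :
    IsGreatest (arpaRatios q k k) (2 / (1 + ∑ i ∈ Finset.range (k + 1),
        (q.choose i : ℝ) * ((q - i - 1).choose (k - i) : ℝ))) ∧
    IsGreatest (cpaRatios q k k) (2 / (1 + ∑ i ∈ Finset.range (k + 1),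
        (q.choose i : ℝ) * ((q - i - 1).choose (k - i) : ℝ))) := by
  have h : ∑ i ∈ Finset.range (k + 1), (q.choose i : ℝ) * ((q - i - 1).choose (k - i) : ℝ) =
      alternatingSum q k := by
    rw [← sum_choose_mul_choose_eq_alternatingSum hkq]
    push_cast
    rfl
  rw [h]
  exact isGreatest_of_attained (fun x hx => le_of_mem_cpaRatios_self hkq hx)
    (exists_mem_arpaRatios_self hk hkq)

theorem isGreatest_one {p q : ℕ} (hp : 0 < p) (hpq : p < q) :
    IsGreatest (arpaRatios q p 1) ((p : ℝ) / q) ∧ IsGreatest (cpaRatios q p 1) ((p : ℝ) / q) :=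
  isGreatest_of_attained (fun _ hx => le_of_mem_cpaRatios_one (hp.trans hpq) hx)
    (exists_mem_arpaRatios_one hp hpq.le)

theorem corollary4p8 (k p q : ℕ) (hk : 1 ≤ k) (hkp : k ≤ p) (hpq : p < q)
    (hcase : p = k ∨ k = 1 ∨ k = 2) :
    -- both suprema are attained maxima
    IsGreatest (arpaRatios q p k) (arpaGamma q p k) ∧
    IsGreatest (cpaRatios q p k) (cpaDelta q p k) ∧
    arpaGamma q p k = cpaDelta q p k ∧
    (p = k → cpaDelta q p k =
      2 / (1 + ∑ i ∈ Finset.range (k + 1),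
        (q.choose i : ℝ) * ((q - i - 1).choose (k - i) : ℝ))) ∧
    (k = 1 → cpaDelta q p k = (p : ℝ) / (q : ℝ)) ∧
    (k = 2 → cpaDelta q p k =
      ((⌈(p : ℝ) / 2⌉ : ℝ) * (⌊(p : ℝ) / 2⌋ : ℝ)) /
        (((q : ℝ) - (⌈(p : ℝ) / 2⌉ : ℝ)) * ((q : ℝ) - (⌊(p : ℝ) / 2⌋ : ℝ)))) := by
  obtain ⟨V, hγ, hδ⟩ : ∃ V, IsGreatest (arpaRatios q p k) V ∧ IsGreatest (cpaRatios q p k) V := by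
    rcases hcase with rfl | rfl | rfl
    · exact ⟨_, isGreatest_self hk hpq⟩
    · exact ⟨_, isGreatest_one hkp hpq⟩
    · exact ⟨_, isGreatest_two hkp hpq⟩
  have eγ : arpaGamma q p k = V := hγ.csSup_eq
  have eδ : cpaDelta q p k = V := hδ.csSup_eq
  rw [eγ, eδ]
  -- The cases overlap, so each formula is identified with `V` by uniqueness of the greatest
  -- element.
  refine ⟨hγ, hδ, rfl, ?_, ?_, ?_⟩
  · rintro rfl
    exact hδ.unique (isGreatest_self hk hpq).2
  · rintro rfl
    exact hδ.unique (isGreatest_one hkp hpq).2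
  · rintro rfl
    exact hδ.unique (isGreatest_two hkp hpq).2
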